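/- **Notation.** Let $q$ be a prime power and $[i]_q=\frac{q^i-1}{q-1}$. For positive integers $r,h$ and $s\in\mathbb N$, a *projective $h$-$(n,r,s)_q$ system* is a multiset of $n$ subspaces of $\mathbb F_q^r$, each of (vector space) dimension at most $h$, such that each hyperplane of $\mathbb F_q^r$ contains at most $s$ elements of the multiset (counted with multiplicity) and some hyperplane contains exactly $s$ of them. Let $n_q(r,h;s)$ be the maximum $n$ for which a projective $h$-$(n,r,s)_q$ system exists (with $n_q(r,h;s)=\infty$ if $n$ is unbounded). The value obtained from linear codes over $\mathbb F_{q^h}$ is $\overline n_q(r,h;s):=n_{q^h}(\lceil r/h\rceil,1;s)$. **Theorem.** For each parameter set $(q,r,h)$ and each triple $(i,c,\delta)$ listed below put $$s_{i,t}:=t\cdot\frac{[r-h]_q}{[\gcd(r,h)]_q}-i .$$ Then, for all sufficiently large $t$, $$n_q(r,h;s_{i,t})=m\,t-c,\qquad n_q(r,h;s_{i,t})-\overline n_q(r,h;s_{i,t})=\delta>0,$$ where $m$ is the number given with the parameter set. In all cases $r/h$ is an integer. - $(q,r,h)=(2,8,2)$, $s_{i,t}=21t-i$, $m=85$: $(i,c,\delta)\in\{(13,55,2),\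 (14,60,2),\ (18,76,2),\ (19,81,2)\}$. - $(q,r,h)=(3,6,2)$, $s_{i,t}=10t-i$, $m=91$: $(i,c,\delta)\in\{(7,67,3),\ (8,77,3),\ (9,87,3)\}$. - $(q,r,h)=(2,9,3)$, $s_{i,t}=9t-i$, $m=73$: $(i,c,\delta)\in\{(5,43,2),\ (6,52,2),\ (7,59,4),\ (8,68,4)\}$. - $(q,r,h)=(4,6,2)$, $s_{i,t}=17t-i$, $m=273$: $(i,c,\delta)\in\{(9,149,4),\ (10,166,4),\ (11,183,4),\ (12,200,4),\ (13,213,8),\ (14,230,8),\ (15,247,8),\ (16,264,8)\}$. - $(q,r,h)=(2,10,2)$, $s_{i,t}=85t-i$, $m=341$: $(i,c,\delta)\in\{(13,55,2),\ (14,60,2),\ (18,76,2),\ (19,81,2),\ (34,140,2),\ (35,145,2),\ (39,161,2),\ (40,166,2),\ (45,183,2),\ (46,188,2),\ (50,204,2),\ (51,209,2),\ (53,215,2),\ (54,220,2),\ (55,223,4),\ (56,228,4),\ (58,236,2),\ (59,241,2),\ (60,244,4),\ (61,249,4),\ (66,268,2),\ (67,273,2),\ (71,289,2),\ (72,294,2),\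 (74,300,2),\ (75,305,2),\ (76,308,4),\ (77,313,4),\ (79,321,2),\ (80,326,2),\ (81,329,4),\ (82,334,4)\}$. - $(q,r,h)=(5,6,2)$, $s_{i,t}=26t-i$, $m=651$: $(i,c,\delta)\in\{(11,281,5),\ (12,307,5),\ (13,333,5),\ (14,359,5),\ (15,385,5),\ (16,406,10),\ (17,432,10),\ (18,458,10),\ (19,484,10),\ (20,510,10),\ (21,531,15),\ (22,557,15),\ (23,583,15),\ (24,609,15),\ (25,635,15)\}$. - $(q,r,h)=(2,12,4)$, $s_{i,t}=17t-i$, $m=273$: $(i,c,\delta)\in\{(7,117,2),\ (8,134,2),\ (9,147,6),\ (10,164,6),\ (11,179,8),\ (12,196,8),\ (13,213,8),\ (14,230,8),\ (15,245,10),\ (16,262,10)\}$. - $(q,r,h)=(3,9,3)$, $s_{i,t}=28t-i$, $m=757$: $(i,c,\delta)\in\{(10,274,6),\ (11,302,6),\ (12,330,6),\ (13,355,9),\ (14,383,9),\ (15,411,9),\ (16,439,9),\ (17,467,9),\ (18,495,9),\ (19,517,15),\ (20,545,15),\ (21,573,15),\ (22,598,18),\ (23,626,18),\ (24,654,18),\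 (25,682,18),\ (26,710,18),\ (27,738,18)\}$. - $(q,r,h)=(3,8,2)$, $s_{i,t}=91t-i$, $m=820$: $(i,c,\delta)\in\{(7,67,3),\ (8,77,3),\ (9,87,3),\ (17,158,3),\ (18,168,3),\ (19,178,3),\ (27,249,3),\ (28,259,3),\ (29,269,3),\ (34,310,3),\ (35,320,3),\ (36,330,3),\ (37,337,6),\ (38,347,6),\ (39,357,6),\ (44,401,3),\ (45,411,3),\ (46,421,3),\ (47,428,6),\ (48,438,6),\ (49,448,6),\ (54,492,3),\ (55,502,3),\ (56,512,3),\ (57,519,6),\ (58,529,6),\ (59,539,6),\ (61,553,3),\ (62,563,3),\ (63,573,3),\ (64,580,6),\ (65,590,6),\ (66,600,6),\ (67,607,9),\ (68,617,9),\ (69,627,9),\ (71,644,3),\ (72,654,3),\ (73,664,3),\ (74,671,6),\ (75,681,6),\ (76,691,6),\ (77,698,9),\ (78,708,9),\ (79,718,9),\ (81,735,3),\ (82,745,3),\ (83,755,3),\ (84,762,6),\ (85,772,6),\ (86,782,6),\ (87,789,9),\ (88,799,9),\ (89,809,9)\}$. -/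

import Mathlib

/-- The `q`-number `[i]_q = (q^i - 1)/(q - 1)` (the division is exact for `q ≥ 2`). -/
def qNum (q i : ℕ) : ℕ := (q ^ i - 1) / (q - 1)

/-- A hyperplane of `PG(r-1, F)`: a subspace of `F^r` of vector space dimension `r - 1`. -/
def IsHyperplane {F : Type*} [Field F] {r : ℕ} (H : Submodule F (Fin r → F)) : Prop :=
  Module.finrank F H + 1 = r

open Classical in
/-- `S` is a projective `h-(n, r, s)_q` system over the field `F` with `q` elements: a multiset of
`n` subspaces of `F^r` of dimension at most `h` such that each hyperplane contains at most `s`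
elements of `S` (counted with multiplicity) and some hyperplane contains exactly `s` of them. -/
structure IsProjectiveSystem (F : Type*) [Field F] (h n r s : ℕ)
    (S : Multiset (Submodule F (Fin r → F))) : Prop where
  card_eq : S.card = n
  finrank_le : ∀ W ∈ S, Module.finrank F W ≤ h
  count_le : ∀ H : Submodule F (Fin r → F), IsHyperplane H → S.countP (fun W => W ≤ H) ≤ s
  exists_count_eq : ∃ H : Submodule F (Fin r → F), IsHyperplane H ∧ S.countP (fun W => W ≤ H) = s

/-- `n_q(r, h; s)` for `q = |F|`: the largest `n` such that a projective `h-(n, r, s)_q` system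
exists. It is `⊤` when there is no largest `n`; a nonzero finite value is always attained. -/
noncomputable def maxLength (F : Type*) [Field F] (r h s : ℕ) : ℕ∞ :=
  sSup ((fun n : ℕ => (n : ℕ∞)) '' {n : ℕ | ∃ S, IsProjectiveSystem F h n r s S})

/-- The value `n_{q^h}(⌈r/h⌉, 1; s)` reached by linear codes over the field `K` with `q^h`
elements. -/
noncomputable def linearMaxLength (K : Type*) [Field K] (r h s : ℕ) : ℕ∞ :=
  maxLength K ⌈(r : ℚ) / (h : ℚ)⌉₊ 1 s

/-- A line of the tables: for the parameters `q, r, h` and `s = t [r-h]_q / [gcd(r,h)]_q - i`, the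
value of `n_q(r, h; s)` is `slope * t - offset`, which exceeds the value for linear codes
by `gain`. -/
structure Series where
  q : ℕ
  r : ℕ
  h : ℕ
  i : ℕ
  slope : ℕ
  offset : ℕ
  gain : ℕ

/-- `s_{i,t} = t [r-h]_q / [gcd(r,h)]_q - i`. The division is exact, and the natural number
subtraction does not truncate once `t` is large. -/
def Series.s (e : Series) (t : ℕ) : ℕ :=
  t * (qNum e.q (e.r - e.h) / qNum e.q (Nat.gcd e.r e.h)) - e.i

/-- The lines with common `q`, `r`, `h` and slope; the remaining data are triples
`(i, offset, gain)`. -/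
def Series.block (q r h slope : ℕ) (l : List (ℕ × ℕ × ℕ)) : List Series :=
  l.map fun x => ⟨q, r, h, x.1, slope, x.2.1, x.2.2⟩

/-- Series for `(q, r, h) = (2, 8, 2)`, with `s = 21 t - i` and length `85 t - offset`. -/
def series_2_8_2 : List Series := Series.block 2 8 2 85
  [(13, 55, 2), (14, 60, 2), (18, 76, 2), (19, 81, 2)]

/-- Series for `(q, r, h) = (3, 6, 2)`, with `s = 10 t - i` and length `91 t - offset`. -/
def series_3_6_2 : List Series := Series.block 3 6 2 91
  [(7, 67, 3), (8, 77, 3), (9, 87, 3)]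

/-- Series for `(q, r, h) = (2, 9, 3)`, with `s = 9 t - i` and length `73 t - offset`. -/
def series_2_9_3 : List Series := Series.block 2 9 3 73
  [(5, 43, 2), (6, 52, 2), (7, 59, 4), (8, 68, 4)]

/-- Series for `(q, r, h) = (4, 6, 2)`, with `s = 17 t - i` and length `273 t - offset`. -/
def series_4_6_2 : List Series := Series.block 4 6 2 273
  [(9, 149, 4), (10, 166, 4), (11, 183, 4), (12, 200, 4), (13, 213, 8), (14, 230, 8),
   (15, 247, 8), (16, 264, 8)]

/-- Series for `(q, r, h) = (2, 10, 2)`, with `s = 85 t - i` and length `341 t - offset`. -/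
def series_2_10_2 : List Series := Series.block 2 10 2 341
  [(13, 55, 2), (14, 60, 2), (18, 76, 2), (19, 81, 2), (34, 140, 2), (35, 145, 2), (39, 161, 2),
   (40, 166, 2), (45, 183, 2), (46, 188, 2), (50, 204, 2), (51, 209, 2), (53, 215, 2),
   (54, 220, 2), (55, 223, 4), (56, 228, 4), (58, 236, 2), (59, 241, 2), (60, 244, 4),
   (61, 249, 4), (66, 268, 2), (67, 273, 2), (71, 289, 2), (72, 294, 2), (74, 300, 2),
   (75, 305, 2), (76, 308, 4), (77, 313, 4), (79, 321, 2), (80, 326, 2), (81, 329, 4),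
   (82, 334, 4)]

/-- Series for `(q, r, h) = (5, 6, 2)`, with `s = 26 t - i` and length `651 t - offset`. -/
def series_5_6_2 : List Series := Series.block 5 6 2 651
  [(11, 281, 5), (12, 307, 5), (13, 333, 5), (14, 359, 5), (15, 385, 5), (16, 406, 10),
   (17, 432, 10), (18, 458, 10), (19, 484, 10), (20, 510, 10), (21, 531, 15), (22, 557, 15),
   (23, 583, 15), (24, 609, 15), (25, 635, 15)]

/-- Series for `(q, r, h) = (2, 12, 4)`, with `s = 17 t - i` and length `273 t - offset`. -/
def series_2_12_4 : List Series := Series.block 2 12 4 273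
  [(7, 117, 2), (8, 134, 2), (9, 147, 6), (10, 164, 6), (11, 179, 8), (12, 196, 8),
   (13, 213, 8), (14, 230, 8), (15, 245, 10), (16, 262, 10)]

/-- Series for `(q, r, h) = (3, 9, 3)`, with `s = 28 t - i` and length `757 t - offset`. -/
def series_3_9_3 : List Series := Series.block 3 9 3 757
  [(10, 274, 6), (11, 302, 6), (12, 330, 6), (13, 355, 9), (14, 383, 9), (15, 411, 9),
   (16, 439, 9), (17, 467, 9), (18, 495, 9), (19, 517, 15), (20, 545, 15), (21, 573, 15),
   (22, 598, 18), (23, 626, 18), (24, 654, 18), (25, 682, 18), (26, 710, 18), (27, 738, 18)]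

/-- Series for `(q, r, h) = (3, 8, 2)`, with `s = 91 t - i` and length `820 t - offset`. -/
def series_3_8_2 : List Series := Series.block 3 8 2 820
  [(7, 67, 3), (8, 77, 3), (9, 87, 3), (17, 158, 3), (18, 168, 3), (19, 178, 3), (27, 249, 3),
   (28, 259, 3), (29, 269, 3), (34, 310, 3), (35, 320, 3), (36, 330, 3), (37, 337, 6),
   (38, 347, 6), (39, 357, 6), (44, 401, 3), (45, 411, 3), (46, 421, 3), (47, 428, 6),
   (48, 438, 6), (49, 448, 6), (54, 492, 3), (55, 502, 3), (56, 512, 3), (57, 519, 6),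
   (58, 529, 6), (59, 539, 6), (61, 553, 3), (62, 563, 3), (63, 573, 3), (64, 580, 6),
   (65, 590, 6), (66, 600, 6), (67, 607, 9), (68, 617, 9), (69, 627, 9), (71, 644, 3),
   (72, 654, 3), (73, 664, 3), (74, 671, 6), (75, 681, 6), (76, 691, 6), (77, 698, 9),
   (78, 708, 9), (79, 718, 9), (81, 735, 3), (82, 745, 3), (83, 755, 3), (84, 762, 6),
   (85, 772, 6), (86, 782, 6), (87, 789, 9), (88, 799, 9), (89, 809, 9)]

/-- All listed parametric series. -/
def improvementSeries : List Series :=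
  series_2_8_2 ++ series_3_6_2 ++ series_2_9_3 ++ series_4_6_2 ++ series_2_10_2 ++
    series_5_6_2 ++ series_2_12_4 ++ series_3_9_3 ++ series_3_8_2

open Module

set_option linter.unusedSectionVars false

/-! ### The numbers `[i]_q` -/

/-! Write `c = i + y`. Both the additive and the linear maximum meet a Griesmer bound, over `F` with
dimension `h` and over `K` with dimension `1` respectively. The slope is the same, and only `y`
differs, by the gain.

Upper bound: replace each `h`-space by its points. A hyperplane containing at most `s` of `n` spaces
misses at least `q^(h-1) * (n - s)` of the points, so the Griesmer bound for multisets of points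
applies (`griesmerSum_le`). Raising `t` by one raises both sides by `[r]_q`, so one numerical check
excludes length `m * t - c + 1` for all larger `t`.

Lower bound, in the manner of Solomon and Stiffler: from `t` copies of the whole space remove
subspaces `U_a` of dimension `h + a`, where `∑ [a]_q = [h]_q * i` and `∑ q^a = y`. The remaining
points have the right hyperplane counts, but must be split into `h`-spaces. In the group of point
functions modulo the lattice of `h`-spaces, pencils give `U_a ≡ -q [a]_q X` for any `(h-1)`-space
`X` in `U_a` (`pointFn_add_smul_mem`). A `2h`-space has a spread, so `q [h]_q X ≡ 0`, and the
removed sum lies in the lattice. Negative coefficients disappear for large `t`, since the whole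
space minus an `h`-space is a sum of `h`-spaces, again by a spread
(`exists_forall_add_smul_mem_subspaceCone`).

In the lemmas on lattices and codes the dimension of the spaces is usually written `h + 1`, so that
`X` has dimension `h`. -/

theorem qNum_eq_sum {q : ℕ} (hq : 2 ≤ q) (n : ℕ) : qNum q n = ∑ k ∈ Finset.range n, q ^ k :=
  (Nat.geomSum_eq hq n).symm

theorem qNum_zero (q : ℕ) : qNum q 0 = 0 := by simp [qNum]

theorem qNum_one {q : ℕ} (hq : 2 ≤ q) : qNum q 1 = 1 := by simp [qNum_eq_sum hq]

theorem qNum_succ {q : ℕ} (hq : 2 ≤ q) (n : ℕ) : qNum q (n + 1) = qNum q n + q ^ n := by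
  simp [qNum_eq_sum hq, Finset.sum_range_succ]

theorem qNum_add {q : ℕ} (hq : 2 ≤ q) (m n : ℕ) :
    qNum q (m + n) = qNum q m + q ^ m * qNum q n := by
  simp [qNum_eq_sum hq, Finset.sum_range_add, Finset.mul_sum, pow_add]

theorem qNum_succ' {q : ℕ} (hq : 2 ≤ q) (n : ℕ) : qNum q (n + 1) = 1 + q * qNum q n := by
  rw [add_comm n 1, qNum_add hq, qNum_one hq, pow_one]

theorem qNum_pos {q : ℕ} (hq : 2 ≤ q) {n : ℕ} (hn : 0 < n) : 0 < qNum q n := by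
  obtain ⟨m, rfl⟩ := Nat.exists_eq_succ_of_ne_zero hn.ne'
  rw [Nat.succ_eq_add_one, qNum_succ' hq]; omega

theorem sub_one_mul_qNum_add_one {q : ℕ} (hq : 2 ≤ q) (n : ℕ) :
    (q - 1) * qNum q n + 1 = q ^ n := by
  obtain ⟨k, rfl⟩ := Nat.exists_eq_add_of_le hq
  induction n with
  | zero => simp [qNum_zero]
  | succ n ih =>
    rw [qNum_succ hq, pow_succ, ← ih, show 2 + k - 1 = k + 1 by omega] at *
    nlinarith

/-! ### Counting points of subspaces -/

section Points

variable {F V : Type*} [Field F] [Finite F] [AddCommGroup V] [Module F V] [Finite V]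

theorem two_le_card (F : Type*) [Field F] [Finite F] : 2 ≤ Nat.card F := Finite.one_lt_card

/-- The number of points of the projective space of `U`. -/
noncomputable def numPoints (U : Submodule F V) : ℕ := qNum (Nat.card F) (finrank F U)

theorem numPoints_add_one (U : Submodule F V) :
    (Nat.card F - 1) * numPoints U + 1 = Nat.card U := by
  rw [numPoints, sub_one_mul_qNum_add_one (two_le_card F), ← Module.natCard_eq_pow_finrank]

theorem numPoints_bot : numPoints (⊥ : Submodule F V) = 0 := by simp [numPoints, qNum_zero]

open Classical in
theorem natCard_eq_sum_ite (U A : Submodule F V) [Fintype V] :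
    Nat.card (U ⊓ A : Submodule F V) = ∑ v : V with v ∈ A, if v ∈ U then 1 else 0 := by
  rw [Finset.sum_ite, Finset.sum_const_zero, add_zero, Finset.sum_const, smul_eq_mul, mul_one,
    Finset.filter_filter, ← SetLike.coe_sort_coe, Nat.card_coe_set_eq, ← Set.ncard_coe_finset]
  congr 1
  ext v
  simp [and_comm]

/-- If the members of a family of subspaces between `Y` and `U` cover each vector of `U` outside of
`Y` exactly once, then counting points in any `A` gives the expected relation. -/
theorem sum_numPoints_of_partition (P : Finset (Submodule F V)) {Y U : Submodule F V}
    (hY : ∀ H ∈ P, Y ≤ H) (hU : ∀ H ∈ P, H ≤ U) (hYU : Y ≤ U)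
    (hP : ∀ v ∈ U, v ∉ Y → ∃! H, H ∈ P ∧ v ∈ H) (A : Submodule F V) :
    ∑ H ∈ P, numPoints (H ⊓ A) + numPoints (Y ⊓ A) =
      numPoints (U ⊓ A) + P.card * numPoints (Y ⊓ A) := by
  classical
  have := Fintype.ofFinite V
  have key : ∑ H ∈ P, Nat.card (H ⊓ A : Submodule F V) + Nat.card (Y ⊓ A : Submodule F V) =
      Nat.card (U ⊓ A : Submodule F V) + P.card * Nat.card (Y ⊓ A : Submodule F V) := by
    simp only [natCard_eq_sum_ite]
    rw [Finset.sum_comm, ← Finset.sum_add_distrib, Finset.mul_sum, ← Finset.sum_add_distrib]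
    refine Finset.sum_congr rfl fun v _ => ?_
    by_cases hvY : v ∈ Y
    · have : ∀ H ∈ P, (if v ∈ H then 1 else 0) = 1 := fun H hH => if_pos (hY H hH hvY)
      rw [Finset.sum_congr rfl this]
      simp [hvY, hYU hvY, add_comm]
    · by_cases hvU : v ∈ U
      · obtain ⟨H₀, ⟨hH₀, hv⟩, huniq⟩ := hP v hvU hvY
        rw [Finset.sum_eq_single H₀]
        · simp [hvY, hvU, hv]
        · exact fun H hH hne => if_neg fun hvH => hne (huniq H ⟨hH, hvH⟩)
        · exact fun h => absurd hH₀ h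
      · have : ∀ H ∈ P, (if v ∈ H then 1 else 0) = 0 :=
          fun H hH => if_neg fun hvH => hvU (hU H hH hvH)
        rw [Finset.sum_congr rfl this]
        simp [hvY, hvU]
  -- Pass from vectors to points: each cardinality is `(q - 1)` times a number of points, plus one.
  -- The ones cancel, as each side has `P.card + 1` of them.
  simp only [← numPoints_add_one] at key
  rw [Finset.sum_add_distrib, ← Finset.mul_sum, Finset.sum_const, smul_eq_mul, mul_one] at key
  have hq : 0 < Nat.card F - 1 := by have := two_le_card F; omega
  refine Nat.eq_of_mul_eq_mul_left hq ?_
  linarith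

open Classical in
/-- The subspaces between `Y` and `U` whose dimension exceeds that of `Y` by one. -/
noncomputable def pencil (Y U : Submodule F V) : Finset (Submodule F V) :=
  have := Fintype.ofFinite (Submodule F V)
  Finset.univ.filter fun H => Y ≤ H ∧ H ≤ U ∧ finrank F H = finrank F Y + 1

theorem mem_pencil {Y U H : Submodule F V} :
    H ∈ pencil Y U ↔ Y ≤ H ∧ H ≤ U ∧ finrank F H = finrank F Y + 1 := by
  simp [pencil]

theorem existsUnique_mem_pencil {Y U : Submodule F V} (hYU : Y ≤ U) {v : V} (hvU : v ∈ U)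
    (hvY : v ∉ Y) : ∃! H, H ∈ pencil Y U ∧ v ∈ H := by
  have hfr := Submodule.finrank_sup_span_singleton hvY
  refine ⟨Y ⊔ Submodule.span F {v}, ⟨mem_pencil.2 ⟨le_sup_left, ?_, hfr⟩, ?_⟩, ?_⟩
  · exact sup_le hYU ((Submodule.span_singleton_le_iff_mem _ _).2 hvU)
  · exact Submodule.mem_sup_right (Submodule.mem_span_singleton_self v)
  · rintro H ⟨hH, hvH⟩
    obtain ⟨h1, -, h3⟩ := mem_pencil.1 hH
    exact (Submodule.eq_of_le_of_finrank_eq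
      (sup_le h1 ((Submodule.span_singleton_le_iff_mem _ _).2 hvH)) (by rw [hfr, h3])).symm

theorem numPoints_eq_of_finrank {U : Submodule F V} {n : ℕ} (h : finrank F U = n) :
    numPoints U = qNum (Nat.card F) n := by rw [numPoints, h]

theorem card_pencil {Y U : Submodule F V} (hYU : Y ≤ U) (h : finrank F U = finrank F Y + 2) :
    (pencil Y U).card = Nat.card F + 1 := by
  have hq := two_le_card F
  have key := sum_numPoints_of_partition (pencil Y U) (fun H hH => (mem_pencil.1 hH).1)
    (fun H hH => (mem_pencil.1 hH).2.1) hYU (fun v => existsUnique_mem_pencil hYU) ⊤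
  simp only [inf_top_eq] at key
  rw [Finset.sum_congr rfl fun H hH => numPoints_eq_of_finrank (mem_pencil.1 hH).2.2,
    numPoints_eq_of_finrank h, numPoints, Finset.sum_const, smul_eq_mul, qNum_succ hq,
    qNum_succ hq, qNum_succ hq] at key
  have hpos : 0 < Nat.card F ^ finrank F Y := by positivity
  refine Nat.eq_of_mul_eq_mul_right hpos ?_
  rw [pow_succ] at key
  linarith

theorem sum_pencil_numPoints {Y U : Submodule F V} (hYU : Y ≤ U)
    (h : finrank F U = finrank F Y + 2) (A : Submodule F V) :
    ∑ H ∈ pencil Y U, numPoints (H ⊓ A) =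
      numPoints (U ⊓ A) + Nat.card F * numPoints (Y ⊓ A) := by
  have key := sum_numPoints_of_partition (pencil Y U) (fun H hH => (mem_pencil.1 hH).1)
    (fun H hH => (mem_pencil.1 hH).2.1) hYU (fun v => existsUnique_mem_pencil hYU) A
  rw [card_pencil hYU h] at key
  linarith

/-! ### Subspaces of prescribed dimension -/

theorem exists_le_finrank_eq {X U : Submodule F V} (hXU : X ≤ U) {n : ℕ}
    (h1 : finrank F X ≤ n) (h2 : n ≤ finrank F U) :
    ∃ Y, X ≤ Y ∧ Y ≤ U ∧ finrank F Y = n := by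
  induction n, h1 using Nat.le_induction with
  | base => exact ⟨X, le_rfl, hXU, rfl⟩
  | succ n _ ih =>
    obtain ⟨Y, hXY, hYU, hY⟩ := ih (by omega)
    have hne : Y ≠ U := by rintro rfl; omega
    obtain ⟨v, hvU, hvY⟩ := SetLike.exists_of_lt (lt_of_le_of_ne hYU hne)
    refine ⟨Y ⊔ Submodule.span F {v}, hXY.trans le_sup_left,
      sup_le hYU ((Submodule.span_singleton_le_iff_mem _ _).2 hvU), ?_⟩
    rw [Submodule.finrank_sup_span_singleton hvY, hY]

theorem exists_finrank_add_one_eq_not_mem {v : V} (hv : v ≠ 0) :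
    ∃ H : Submodule F V, finrank F H + 1 = finrank F V ∧ v ∉ H := by
  obtain ⟨H, hH⟩ := Submodule.exists_isCompl (Submodule.span F {v})
  refine ⟨H, ?_, fun hvH => hv ?_⟩
  · rw [← Submodule.finrank_add_eq_of_isCompl hH, finrank_span_singleton hv, add_comm]
  · exact Submodule.disjoint_def.1 hH.disjoint v (Submodule.mem_span_singleton_self v) hvH

theorem finrank_le_finrank_inf_add_one (U : Submodule F V) {H : Submodule F V}
    (hH : finrank F H + 1 = finrank F V) :
    finrank F U ≤ finrank F (U ⊓ H : Submodule F V) + 1 := by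
  have h1 := Submodule.finrank_sup_add_finrank_inf_eq U H
  have h2 := Submodule.finrank_le (U ⊔ H)
  omega

theorem finrank_inf_add_one_eq {U H : Submodule F V} (hH : finrank F H + 1 = finrank F V)
    (hUH : ¬U ≤ H) : finrank F (U ⊓ H : Submodule F V) + 1 = finrank F U := by
  have h1 := finrank_le_finrank_inf_add_one U hH
  have h2 : finrank F (U ⊓ H : Submodule F V) < finrank F U :=
    Submodule.finrank_lt_finrank_of_lt (inf_lt_left.2 hUH)
  omega

/-! ### The Griesmer bound -/

/-- The Griesmer sum `∑_{i < r} ⌈D / q ^ i⌉`. -/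
def griesmerSum (q : ℕ) : ℕ → ℕ → ℕ
  | 0, _ => 0
  | r + 1, D => D + griesmerSum q r ((D + (q - 1)) / q)

/-- `q ^ r * t` is divisible by every `q ^ j` with `j ≤ r`, so it passes through all the roundings.
This periodicity reduces the upper bound to a single value of `t`. -/
theorem griesmerSum_add {q : ℕ} (hq : 2 ≤ q) (r t D : ℕ) :
    griesmerSum q (r + 1) (q ^ r * t + D) = qNum q (r + 1) * t + griesmerSum q (r + 1) D := by
  induction r generalizing D with
  | zero => simp [griesmerSum, qNum_one hq]
  | succ r ih =>
    rw [griesmerSum, griesmerSum.eq_2 q D (r + 1), qNum_succ hq (r + 1), add_mul,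
      show (q ^ (r + 1) * t + D + (q - 1)) / q = q ^ r * t + (D + (q - 1)) / q by
        rw [pow_succ', mul_assoc, add_assoc, Nat.mul_add_div (by omega)], ih]
    ring

/-- The Griesmer bound for a weight function on subspaces which is additive on pencils. -/
theorem griesmerSum_le (w : Submodule F V → ℕ)
    (hw : ∀ Y U : Submodule F V, Y ≤ U → finrank F U = finrank F Y + 2 →
      ∑ H ∈ pencil Y U, w H = w U + Nat.card F * w Y)
    (r D : ℕ) (U : Submodule F V) (hU : finrank F U = r)
    (hD : ∀ H ≤ U, finrank F H + 1 = r → w H + D ≤ w U) :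
    griesmerSum (Nat.card F) r D ≤ w U := by
  have hq := two_le_card F
  induction r generalizing D U with
  | zero => exact Nat.zero_le _
  | succ r ih =>
    obtain ⟨H, ⟨hHU, hHr⟩, hmax⟩ : ∃ H, (H ≤ U ∧ finrank F H = r) ∧
        ∀ H', (H' ≤ U ∧ finrank F H' = r) → w H' ≤ w H := by
      obtain ⟨H₀, -, h2, h3⟩ := exists_le_finrank_eq (bot_le : ⊥ ≤ U) (n := r)
        (by simp) (by omega)
      obtain ⟨H, hH, hmax⟩ := Set.exists_max_image {H : Submodule F V | H ≤ U ∧ finrank F H = r} w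
        (Set.toFinite _) ⟨H₀, h2, h3⟩
      exact ⟨H, hH, hmax⟩
    have hrec := ih ((D + (Nat.card F - 1)) / Nat.card F) H hHr ?_
    · have := hD H hHU (by omega)
      rw [griesmerSum]
      omega
    · intro Y hYH hY
      have hsum := hw Y U (hYH.trans hHU) (by omega)
      -- Each of the `q + 1` members of the pencil weighs at most as much as the heaviest one, `H`.
      -- With `w H + D ≤ w U` this gives `q * w Y + D ≤ q * w H`, so `H` satisfies the hypothesis
      -- with `⌈D / q⌉`.
      have hle : ∑ H' ∈ pencil Y U, w H' ≤ (Nat.card F + 1) * w H := by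
        rw [← card_pencil (hYH.trans hHU) (by omega : finrank F U = finrank F Y + 2),
          ← smul_eq_mul]
        refine Finset.sum_le_card_nsmul _ _ _ fun H' hH' => hmax H' ?_
        obtain ⟨-, h2, h3⟩ := mem_pencil.1 hH'
        exact ⟨h2, by omega⟩
      have hDU := hD H hHU (by omega)
      have hmul : Nat.card F * w Y + D ≤ Nat.card F * w H := by nlinarith
      have hYle : w Y ≤ w H := by
        by_contra hcon
        have := Nat.mul_lt_mul_of_pos_left (not_le.1 hcon) (by omega : 0 < Nat.card F)
        omega
      obtain ⟨k, hk⟩ := Nat.exists_eq_add_of_le hYle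
      rw [hk, mul_add] at hmul
      have : (D + (Nat.card F - 1)) / Nat.card F ≤ k := by
        rw [Nat.div_le_iff_le_mul (by omega), mul_comm]
        omega
      omega

end Points

/-! ### Griesmer bound for multisets of subspaces -/

section UpperBound

variable {F : Type*} [Field F] [Finite F]

theorem sum_map_pencil_numPoints {V : Type*} [AddCommGroup V] [Module F V] [Finite V]
    (S : Multiset (Submodule F V)) {Y U : Submodule F V} (hYU : Y ≤ U)
    (h : finrank F U = finrank F Y + 2) :
    ∑ H ∈ pencil Y U, (S.map fun W => numPoints (W ⊓ H)).sum =
      (S.map fun W => numPoints (W ⊓ U)).sum +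
        Nat.card F * (S.map fun W => numPoints (W ⊓ Y)).sum := by
  induction S using Multiset.induction with
  | empty => simp
  | cons W S ih =>
    simp only [Multiset.map_cons, Multiset.sum_cons, Finset.sum_add_distrib, ih]
    have := sum_pencil_numPoints hYU h W
    simp only [inf_comm W]
    linarith

open Classical in
/-- Counting the points of a multiset of `h`-dimensional subspaces in a hyperplane. -/
theorem sum_numPoints_inf_add {r h : ℕ} (S : Multiset (Submodule F (Fin r → F)))
    (hS : ∀ W ∈ S, finrank F W = h + 1) {H : Submodule F (Fin r → F)} (hH : IsHyperplane H) :
    (S.map fun W => numPoints (W ⊓ H)).sum =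
      qNum (Nat.card F) h * S.card + Nat.card F ^ h * S.countP (fun W => W ≤ H) := by
  have hq := two_le_card F
  induction S using Multiset.induction with
  | empty => simp
  | cons W S ih =>
    have hW := hS W (Multiset.mem_cons_self _ _)
    rw [Multiset.map_cons, Multiset.sum_cons,
      ih fun W' hW' => hS W' (Multiset.mem_cons_of_mem hW'), Multiset.card_cons,
      Multiset.countP_cons]
    split_ifs with hle
    · rw [inf_eq_left.2 hle, numPoints_eq_of_finrank hW, qNum_succ hq]; ring
    · have := finrank_inf_add_one_eq (by simpa [IsHyperplane] using hH) hle
      rw [numPoints_eq_of_finrank (by omega : finrank F (W ⊓ H : Submodule F _) = h)]; ring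

open Classical in
/-- The Griesmer bound for additive codes, in terms of `h`-dimensional subspaces. -/
theorem griesmerSum_le_of_forall_countP_le {r h s D : ℕ} (S : Multiset (Submodule F (Fin r → F)))
    (hS : ∀ W ∈ S, finrank F W = h + 1)
    (hcount : ∀ H : Submodule F (Fin r → F), IsHyperplane H → S.countP (fun W => W ≤ H) ≤ s)
    (hD : s + D ≤ S.card) :
    griesmerSum (Nat.card F) r (Nat.card F ^ h * D) ≤ qNum (Nat.card F) (h + 1) * S.card := by
  have hq := two_le_card F
  have htop : (S.map fun W => numPoints (W ⊓ ⊤)).sum = qNum (Nat.card F) (h + 1) * S.card := by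
    simp only [inf_top_eq]
    rw [Multiset.map_congr rfl fun W hW => numPoints_eq_of_finrank (hS W hW)]
    simp [mul_comm]
  rw [← htop]
  refine griesmerSum_le (fun A => (S.map fun W => numPoints (W ⊓ A)).sum)
    (fun Y U hYU h2 => sum_map_pencil_numPoints S hYU h2) r _ ⊤ (by simp) fun H _ hH => ?_
  have hc := hcount H hH
  rw [htop, sum_numPoints_inf_add S hS hH, qNum_succ hq]
  have : Nat.card F ^ h * (S.countP (fun W => W ≤ H) + D) ≤ Nat.card F ^ h * S.card :=
    Nat.mul_le_mul_left _ (by omega)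
  linarith

theorem exists_submultiset_card_eq {α : Type*} {S : Multiset α} {n : ℕ} (h : n ≤ S.card) :
    ∃ T ≤ S, T.card = n := by
  have : 0 < (Multiset.powersetCard n S).card := by
    rw [Multiset.card_powersetCard]; exact Nat.choose_pos h
  obtain ⟨T, hT⟩ := Multiset.card_pos_iff_exists_mem.1 this
  exact ⟨T, Multiset.mem_powersetCard.1 hT⟩

open Classical in
/-- The Griesmer bound for projective systems, for any length below the actual one. -/
theorem IsProjectiveSystem.griesmerSum_le {r h n s N D : ℕ}
    {S : Multiset (Submodule F (Fin r → F))} (hS : IsProjectiveSystem F (h + 1) n r s S)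
    (hr : h + 1 ≤ r) (hN : N ≤ n) (hD : s + D ≤ N) :
    griesmerSum (Nat.card F) r (Nat.card F ^ h * D) ≤ qNum (Nat.card F) (h + 1) * N := by
  -- Discarding members, and enlarging the others to dimension exactly `h + 1`, cannot increase the
  -- number contained in a hyperplane.
  obtain ⟨T, hTS, hT⟩ := exists_submultiset_card_eq (hN.trans_eq hS.card_eq.symm)
  have hex : ∀ W : Submodule F (Fin r → F), ∃ W', finrank F W ≤ h + 1 →
      W ≤ W' ∧ finrank F W' = h + 1 := by
    intro W
    by_cases hW : finrank F W ≤ h + 1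
    · obtain ⟨W', h1, -, h2⟩ := exists_le_finrank_eq (le_top : W ≤ ⊤) hW (by simpa using hr)
      exact ⟨W', fun _ => ⟨h1, h2⟩⟩
    · exact ⟨W, fun h => absurd h hW⟩
  choose f hf using hex
  have hfT : ∀ W ∈ T, W ≤ f W ∧ finrank F (f W) = h + 1 :=
    fun W hW => hf W (hS.finrank_le W (Multiset.mem_of_le hTS hW))
  have key := griesmerSum_le_of_forall_countP_le (s := s) (D := D) (h := h) (T.map f) ?_ ?_ ?_
  · simpa [hT] using key
  · intro W hW
    obtain ⟨W', hW', rfl⟩ := Multiset.mem_map.1 hW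
    exact (hfT W' hW').2
  · intro H hH
    rw [Multiset.countP_map, ← Multiset.countP_eq_card_filter]
    refine le_trans ?_ ((Multiset.countP_le_of_le _ hTS).trans (hS.count_le H hH))
    rw [Multiset.countP_eq_card_filter, Multiset.countP_eq_card_filter]
    have : T.filter (fun W => f W ≤ H) ≤ T.filter (fun W => W ≤ H) := by
      rw [Multiset.le_filter]
      refine ⟨Multiset.filter_le _ _, fun W hW => ?_⟩
      rw [Multiset.mem_filter] at hW
      exact (hfT W hW.1).1.trans hW.2
    exact Multiset.card_le_card this
  · simpa [hT] using hD

/-- If the Griesmer bound excludes length `m * T - c + 1` for `s = σ * T - i`, then it does so for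
all larger values of `T`. -/
theorem IsProjectiveSystem.le_of_griesmerSum {r h n σ m i y T : ℕ} (hr : h + 1 ≤ r)
    {t : ℕ} (ht : T ≤ t) (hm : qNum (Nat.card F) (h + 1) * m = qNum (Nat.card F) r)
    (hσm : m = σ + Nat.card F ^ (r - (h + 1))) (hi : i ≤ σ * T)
    (hy : y ≤ Nat.card F ^ (r - (h + 1)) * T)
    (hT : qNum (Nat.card F) (h + 1) * (m * T + 1 - (i + y)) <
      griesmerSum (Nat.card F) r
        (Nat.card F ^ h * (Nat.card F ^ (r - (h + 1)) * T + 1 - y)))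
    {S : Multiset (Submodule F (Fin r → F))}
    (hS : IsProjectiveSystem F (h + 1) n r (σ * t - i) S) : n ≤ m * t - (i + y) := by
  by_contra! hcon
  obtain ⟨u, rfl⟩ := Nat.exists_eq_add_of_le ht
  set q := Nat.card F with hqdef
  have hq : 2 ≤ q := two_le_card F
  have hmT : m * T = σ * T + q ^ (r - (h + 1)) * T := by rw [hσm, add_mul]
  have hmu : m * u = σ * u + q ^ (r - (h + 1)) * u := by rw [hσm, add_mul]
  -- The excluded length is the first one beyond the claim; any longer system is cut down to it.
  have key := hS.griesmerSum_le (N := m * (T + u) + 1 - (i + y))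
    (D := q ^ (r - (h + 1)) * (T + u) + 1 - y) hr (by omega) (by
      rw [mul_add, mul_add, mul_add]; omega)
  obtain ⟨r', rfl⟩ := Nat.exists_eq_add_of_le' (by omega : 1 ≤ r)
  have e1 : q ^ h * (q ^ (r' + 1 - (h + 1)) * (T + u) + 1 - y) =
      q ^ r' * u + q ^ h * (q ^ (r' + 1 - (h + 1)) * T + 1 - y) := by
    have : q ^ r' = q ^ h * q ^ (r' + 1 - (h + 1)) := by rw [← pow_add]; congr 1; omega
    rw [this, mul_assoc, ← mul_add]
    congr 1
    rw [mul_add]; omega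
  have e2 : m * (T + u) + 1 - (i + y) = m * u + (m * T + 1 - (i + y)) := by
    rw [mul_add]; omega
  rw [← hqdef, e1, griesmerSum_add hq, e2, mul_add, ← mul_assoc, hm] at key
  omega

end UpperBound

/-! ### Desarguesian spreads -/

section Spread

variable {F V : Type*} [Field F] [Finite F] [AddCommGroup V] [Module F V] [Finite V]

theorem finrank_map_of_injective {V' : Type*} [AddCommGroup V'] [Module F V']
    {f : V' →ₗ[F] V} (hf : Function.Injective f) (U : Submodule F V') :
    finrank F (U.map f) = finrank F U :=
  (Submodule.equivMapOfInjective f hf U).finrank_eq.symm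

open Classical in
/-- The images of the one-dimensional subspaces over an extension field, as subspaces over the
ground field. -/
noncomputable def desarguesianSpread (K : Type*) {V' : Type*} [Field K] [Algebra F K]
    [AddCommGroup V'] [Module F V'] [Module K V'] [IsScalarTower F K V'] (f : V' →ₗ[F] V) :
    Finset (Submodule F V) :=
  have := Fintype.ofFinite (Submodule F V)
  Finset.univ.filter fun W => ∃ v : V', v ≠ 0 ∧
    W = ((Submodule.span K {v}).restrictScalars F).map f

theorem mem_desarguesianSpread {K V' : Type*} [Field K] [Algebra F K]
    [AddCommGroup V'] [Module F V'] [Module K V'] [IsScalarTower F K V'] {f : V' →ₗ[F] V}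
    {W : Submodule F V} : W ∈ desarguesianSpread K f ↔ ∃ v : V', v ≠ 0 ∧
      W = ((Submodule.span K {v}).restrictScalars F).map f := by
  simp [desarguesianSpread]

theorem finrank_of_mem_desarguesianSpread {K V' : Type*} [Field K] [Algebra F K]
    [AddCommGroup V'] [Module F V'] [Module K V'] [IsScalarTower F K V'] {f : V' →ₗ[F] V}
    (hf : Function.Injective f) {W : Submodule F V} (hW : W ∈ desarguesianSpread K f) :
    finrank F W = finrank F K := by
  obtain ⟨v, hv, rfl⟩ := mem_desarguesianSpread.1 hW
  rw [finrank_map_of_injective hf]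
  change finrank F (Submodule.span K {v}) = _
  rw [← finrank_mul_finrank F K (Submodule.span K {v}), finrank_span_singleton hv, mul_one]

/-- Distinct lines over `K` meet only in zero, so they partition the nonzero vectors, and the
injective `f` preserves this. -/
theorem sum_desarguesianSpread_numPoints {K V' : Type*} [Field K] [Algebra F K]
    [AddCommGroup V'] [Module F V'] [Module K V'] [IsScalarTower F K V'] {f : V' →ₗ[F] V}
    (hf : Function.Injective f) (A : Submodule F V) :
    ∑ W ∈ desarguesianSpread K f, numPoints (W ⊓ A) = numPoints (LinearMap.range f ⊓ A) := by
  have key := sum_numPoints_of_partition (desarguesianSpread K f) (Y := ⊥)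
    (U := LinearMap.range f) (fun _ _ => bot_le) ?_ bot_le ?_ A
  · simpa [numPoints_bot] using key
  · intro W hW
    obtain ⟨v, -, rfl⟩ := mem_desarguesianSpread.1 hW
    exact LinearMap.map_le_range
  · rintro _ ⟨v, rfl⟩ hv
    have hv0 : v ≠ 0 := by rintro rfl; simp at hv
    refine ⟨_, ⟨mem_desarguesianSpread.2 ⟨v, hv0, rfl⟩, ?_⟩, ?_⟩
    · exact Submodule.mem_map_of_mem (Submodule.mem_span_singleton_self v)
    · rintro W ⟨hW, hvW⟩
      obtain ⟨u, hu, rfl⟩ := mem_desarguesianSpread.1 hW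
      obtain ⟨x, hx, hxv⟩ := Submodule.mem_map.1 hvW
      rw [hf hxv] at hx
      obtain ⟨a, rfl⟩ := Submodule.mem_span_singleton.1 hx
      have ha : a ≠ 0 := by rintro rfl; simp at hv0
      rw [Submodule.span_singleton_smul_eq (IsUnit.mk0 a ha)]

/-- A subspace whose dimension is a multiple of `h` has a spread of `h`-dimensional subspaces which
contains a given one. -/
theorem exists_spread {h m : ℕ} (hh : 0 < h) {W U : Submodule F V} (hWU : W ≤ U)
    (hW : finrank F W = h) (hU : finrank F U = (m + 1) * h) :
    ∃ P : Finset (Submodule F V), W ∈ P ∧ (∀ H ∈ P, finrank F H = h) ∧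
      ∀ A, ∑ H ∈ P, numPoints (H ⊓ A) = numPoints (U ⊓ A) := by
  have : NeZero h := ⟨hh.ne'⟩
  obtain ⟨p, hp⟩ := CharP.exists F
  have : Fact p.Prime := ⟨CharP.char_is_prime F p⟩
  let K := FiniteField.Extension F p h
  have hK : finrank F K = h := FiniteField.finrank_extension F p h
  obtain ⟨C, hC⟩ := Submodule.exists_isCompl W
  have hsup : W ⊔ C ⊓ U = U := by rw [← sup_inf_assoc_of_le C hWU, hC.sup_eq_top, top_inf_eq]
  have hdisj : Disjoint W (C ⊓ U) := hC.disjoint.mono_right inf_le_left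
  have hC' : finrank F (C ⊓ U : Submodule F V) = m * h := by
    have := Submodule.finrank_sup_add_finrank_inf_eq W (C ⊓ U)
    rw [hsup, hdisj.eq_bot, finrank_bot, hU, hW, add_mul] at this
    omega
  -- `U = W ⊕ (C ⊓ U)` is identified with `K × K^m` so that `W` becomes the `K`-line of `(1, 0)`,
  -- hence a spread element.
  let e₁ : K ≃ₗ[F] W := LinearEquiv.ofFinrankEq _ _ (by rw [hK, hW])
  let e₂ : (Fin m → K) ≃ₗ[F] (C ⊓ U : Submodule F V) := LinearEquiv.ofFinrankEq _ _ (by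
    rw [Module.finrank_pi_fintype, hC']; simp [hK])
  let f₁ : K →ₗ[F] V := W.subtype ∘ₗ e₁
  let f₂ : (Fin m → K) →ₗ[F] V := (C ⊓ U).subtype ∘ₗ e₂
  have hr₁ : LinearMap.range f₁ = W := by simp [f₁, LinearMap.range_comp]
  have hr₂ : LinearMap.range f₂ = C ⊓ U := by
    simp only [f₂, LinearMap.range_comp, LinearEquiv.range, Submodule.map_top,
      Submodule.range_subtype]
  have hf₁ : Function.Injective f₁ := Subtype.val_injective.comp e₁.injective
  have hf₂ : Function.Injective f₂ := Subtype.val_injective.comp e₂.injective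
  have hf : Function.Injective (f₁.coprod f₂) := by
    rw [← LinearMap.ker_eq_bot, LinearMap.ker_coprod_of_disjoint_range _ _ (by rwa [hr₁, hr₂]),
      LinearMap.ker_eq_bot.2 hf₁, LinearMap.ker_eq_bot.2 hf₂, Submodule.prod_bot]
  refine ⟨desarguesianSpread K (f₁.coprod f₂), ?_, ?_, fun A => ?_⟩
  · refine mem_desarguesianSpread.2 ⟨(1, 0), by simp, ?_⟩
    refine Submodule.eq_of_le_of_finrank_eq ?_ ?_
    · intro w hw
      refine Submodule.mem_map.2 ⟨(e₁.symm ⟨w, hw⟩, 0),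
        Submodule.mem_span_singleton.2 ⟨e₁.symm ⟨w, hw⟩, by simp⟩, by simp [f₁]⟩
    · rw [finrank_of_mem_desarguesianSpread (K := K) hf
        (mem_desarguesianSpread.2 ⟨(1, 0), by simp, rfl⟩), hK, hW]
  · intro H hH
    rw [finrank_of_mem_desarguesianSpread hf hH, hK]
  · rw [sum_desarguesianSpread_numPoints hf, LinearMap.range_coprod, hr₁, hr₂, hsup]

end Spread

/-! ### The lattice and the cone generated by the `h`-dimensional subspaces -/

section Lattice

variable {F V : Type*} [Field F] [Finite F] [AddCommGroup V] [Module F V] [Finite V]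

/-- The number of points that `U` shares with each subspace. -/
noncomputable def pointFn (U : Submodule F V) : Submodule F V → ℤ := fun A => numPoints (U ⊓ A)

variable (F V) in
/-- The lattice generated by the `h`-dimensional subspaces. -/
def subspaceLattice (h : ℕ) : AddSubgroup (Submodule F V → ℤ) :=
  AddSubgroup.closure (pointFn '' {W : Submodule F V | finrank F W = h})

variable (F V) in
/-- The sums of `h`-dimensional subspaces. -/
def subspaceCone (h : ℕ) : AddSubmonoid (Submodule F V → ℤ) :=
  AddSubmonoid.closure (pointFn '' {W : Submodule F V | finrank F W = h})

theorem pointFn_mem_subspaceLattice {h : ℕ} {W : Submodule F V} (hW : finrank F W = h) :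
    pointFn W ∈ subspaceLattice F V h :=
  AddSubgroup.subset_closure ⟨W, hW, rfl⟩

theorem pointFn_mem_subspaceCone {h : ℕ} {W : Submodule F V} (hW : finrank F W = h) :
    pointFn W ∈ subspaceCone F V h :=
  AddSubmonoid.subset_closure ⟨W, hW, rfl⟩

theorem exists_multiset_of_mem_subspaceCone {h : ℕ} {f : Submodule F V → ℤ}
    (hf : f ∈ subspaceCone F V h) :
    ∃ S : Multiset (Submodule F V), (∀ W ∈ S, finrank F W = h) ∧
      ∀ A, ((S.map fun W => numPoints (W ⊓ A)).sum : ℤ) = f A := by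
  induction hf using AddSubmonoid.closure_induction with
  | mem f hf =>
    obtain ⟨W, hW, rfl⟩ := hf
    exact ⟨{W}, by simpa using hW, by simp [pointFn]⟩
  | zero => exact ⟨0, by simp, by simp⟩
  | add f g _ _ ihf ihg =>
    obtain ⟨S, hS, hSf⟩ := ihf
    obtain ⟨T, hT, hTg⟩ := ihg
    refine ⟨S + T, fun W hW => (Multiset.mem_add.1 hW).elim (hS W) (hT W), fun A => ?_⟩
    rw [Multiset.map_add, Multiset.sum_add, Nat.cast_add, hSf, hTg, Pi.add_apply]

theorem sum_pencil_pointFn {Y U : Submodule F V} (hYU : Y ≤ U)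
    (h : finrank F U = finrank F Y + 2) :
    ∑ H ∈ pencil Y U, pointFn H = pointFn U + Nat.card F • pointFn Y := by
  ext A
  simpa [pointFn] using congrArg (Nat.cast (R := ℤ)) (sum_pencil_numPoints hYU h A)

/-- Modulo the lattice of `h`-dimensional subspaces, a subspace of dimension `h + c` is the negative
of a multiple of any `(h-1)`-dimensional subspace contained in it. -/
theorem pointFn_add_smul_mem {h : ℕ} (c : ℕ) {X U : Submodule F V} (hXU : X ≤ U)
    (hX : finrank F X = h) (hU : finrank F U = h + 1 + c) :
    pointFn U + (qNum (Nat.card F) c * Nat.card F) • pointFn X ∈ subspaceLattice F V (h + 1) := by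
  have hq := two_le_card F
  induction c using Nat.strong_induction_on generalizing U with
  | _ c ih =>
    match c with
    | 0 => simpa [qNum_zero] using pointFn_mem_subspaceLattice hU
    | 1 =>
      rw [qNum_one hq, one_mul, ← sum_pencil_pointFn hXU (by omega)]
      refine AddSubgroup.sum_mem _ fun H hH => pointFn_mem_subspaceLattice ?_
      rw [(mem_pencil.1 hH).2.2, hX]
    | c + 2 =>
      obtain ⟨Y, hXY, hYU, hY⟩ := exists_le_finrank_eq hXU (n := h + 1 + c) (by omega) (by omega)
      have h1 : ∑ H ∈ pencil Y U, (pointFn H + (qNum (Nat.card F) (c + 1) * Nat.card F) •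
          pointFn X) ∈ subspaceLattice F V (h + 1) := by
        refine AddSubgroup.sum_mem _ fun H hH => ih (c + 1) (by omega) ?_ ?_
        · exact hXY.trans (mem_pencil.1 hH).1
        · rw [(mem_pencil.1 hH).2.2, hY]; ring
      have h2 := AddSubgroup.nsmul_mem _ (ih c (by omega) hXY hY) (Nat.card F)
      rw [Finset.sum_add_distrib, sum_pencil_pointFn hYU (by omega), Finset.sum_const,
        card_pencil hYU (by omega)] at h1
      -- The coefficients of `X` agree because `(q + 1) [c+1]_q - q [c]_q = [c+2]_q`.
      convert AddSubgroup.sub_mem _ h1 h2 using 1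
      ext A
      simp only [Pi.add_apply, Pi.sub_apply, nsmul_eq_mul, Pi.mul_apply,
        Pi.natCast_apply, Nat.cast_mul]
      rw [qNum_succ' hq (c + 1), qNum_succ' hq c]
      push_cast
      ring

/-- `[h]_q` annihilates the class of `q` times an `(h-1)`-dimensional subspace. -/
theorem qNum_mul_smul_pointFn_mem {h : ℕ} {X : Submodule F V} (hX : finrank F X = h)
    (hV : 2 * (h + 1) ≤ finrank F V) :
    (qNum (Nat.card F) (h + 1) * Nat.card F) • pointFn X ∈ subspaceLattice F V (h + 1) := by
  obtain ⟨W, hXW, -, hW⟩ := exists_le_finrank_eq (le_top : X ≤ ⊤) (n := h + 1) (by omega)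
    (by rw [finrank_top]; omega)
  obtain ⟨U, hWU, -, hU⟩ := exists_le_finrank_eq (le_top : W ≤ ⊤) (n := 2 * (h + 1)) (by omega)
    (by rwa [finrank_top])
  obtain ⟨P, -, hP, hsum⟩ := exists_spread (m := 1) (by omega) hWU hW (by omega)
  have hUmem : pointFn U ∈ subspaceLattice F V (h + 1) := by
    have : pointFn U = ∑ H ∈ P, pointFn H := by
      ext A
      simpa [pointFn] using congrArg (Nat.cast (R := ℤ)) (hsum A).symm
    rw [this]
    exact AddSubgroup.sum_mem _ fun H hH => pointFn_mem_subspaceLattice (hP H hH)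
  -- `U` has dimension `(h + 1) + (h + 1)`, and its own class is zero by the spread, so only the
  -- multiple of `X` is left.
  have := pointFn_add_smul_mem (h + 1) (hXW.trans hWU) hX (by omega)
  rwa [AddSubgroup.add_mem_cancel_left _ hUmem] at this

/-- Take a spread of the whole space through `W` and omit `W`. Hence one copy of the whole space
pays for one negative generator. -/
theorem exists_pointFn_sub_mem_subspaceCone {h k : ℕ} (hh : 0 < h) (hV : finrank F V = k * h)
    {W : Submodule F V} (hW : finrank F W = h) :
    pointFn (⊤ : Submodule F V) - pointFn W ∈ subspaceCone F V h := by
  classical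
  have hk : k ≠ 0 := by
    rintro rfl
    have := Submodule.finrank_le W
    omega
  obtain ⟨m, rfl⟩ := Nat.exists_eq_succ_of_ne_zero hk
  obtain ⟨P, hWP, hP, hsum⟩ := exists_spread hh (le_top : W ≤ ⊤) hW (by rwa [finrank_top])
  have : pointFn (⊤ : Submodule F V) - pointFn W = ∑ H ∈ P.erase W, pointFn H := by
    rw [sub_eq_iff_eq_add, Finset.sum_erase_add _ _ hWP]
    ext A
    simpa [pointFn] using congrArg (Nat.cast (R := ℤ)) (hsum A).symm
  rw [this]
  exact AddSubmonoid.sum_mem _ fun H hH =>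
    pointFn_mem_subspaceCone (hP H (Finset.mem_of_mem_erase hH))

theorem pointFn_top_mem_subspaceCone {h k : ℕ} (hh : 0 < h) (hV : finrank F V = k * h)
    (hk : 0 < k) : pointFn (⊤ : Submodule F V) ∈ subspaceCone F V h := by
  obtain ⟨W, -, -, hW⟩ := exists_le_finrank_eq (bot_le : (⊥ : Submodule F V) ≤ ⊤) (n := h)
    (by simp) (by rw [finrank_top, hV]; exact Nat.le_mul_of_pos_left _ hk)
  have := AddSubmonoid.add_mem _ (exists_pointFn_sub_mem_subspaceCone hh hV hW)
    (pointFn_mem_subspaceCone hW)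
  rwa [sub_add_cancel] at this

/-- Adding sufficiently many copies of the whole space turns each element of the lattice into a sum
of subspaces. -/
theorem exists_forall_add_smul_mem_subspaceCone {h k : ℕ} (hh : 0 < h)
    (hV : finrank F V = k * h) (hk : 0 < k) {f : Submodule F V → ℤ}
    (hf : f ∈ subspaceLattice F V h) :
    ∃ T : ℕ, ∀ t ≥ T, f + t • pointFn (⊤ : Submodule F V) ∈ subspaceCone F V h := by
  have htop := pointFn_top_mem_subspaceCone (F := F) hh hV hk
  rw [subspaceLattice, ← AddSubgroup.mem_toAddSubmonoid, AddSubgroup.closure_toAddSubmonoid] at hf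
  induction hf using AddSubmonoid.closure_induction with
  | mem f hf =>
    rcases hf with ⟨W, hW, rfl⟩ | ⟨W, hW, hf⟩
    · exact ⟨0, fun t _ => AddSubmonoid.add_mem _ (pointFn_mem_subspaceCone hW)
        (AddSubmonoid.nsmul_mem _ htop t)⟩
    · refine ⟨1, fun t ht => ?_⟩
      obtain ⟨u, rfl⟩ := Nat.exists_eq_add_of_le ht
      rw [eq_neg_of_add_eq_zero_right (by rw [hf]; simp : pointFn W + f = 0), add_smul, one_smul,
        ← add_assoc, neg_add_eq_sub]
      exact AddSubmonoid.add_mem _ (exists_pointFn_sub_mem_subspaceCone hh hV hW)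
        (AddSubmonoid.nsmul_mem _ htop u)
  | zero => exact ⟨0, fun t _ => by rw [zero_add]; exact AddSubmonoid.nsmul_mem _ htop t⟩
  | add f g _ _ ihf ihg =>
    obtain ⟨T₁, h₁⟩ := ihf
    obtain ⟨T₂, h₂⟩ := ihg
    refine ⟨T₁ + T₂, fun t ht => ?_⟩
    obtain ⟨u, rfl⟩ := Nat.exists_eq_add_of_le ht
    convert AddSubmonoid.add_mem _ (h₁ T₁ le_rfl) (h₂ (T₂ + u) (by omega)) using 1
    rw [add_assoc T₁ T₂ u, add_smul T₁]
    abel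

end Lattice

/-! ### Projective systems obtained by removing subspaces -/

section Construction

variable {F : Type*} [Field F] [Finite F]

theorem list_sum_qNum_add {q : ℕ} (hq : 2 ≤ q) (h : ℕ) (J : List ℕ) :
    (J.map fun a => qNum q (h + a)).sum =
      (J.map (qNum q)).sum + qNum q h * (J.map (q ^ ·)).sum := by
  induction J with
  | nil => simp
  | cons a J ih =>
    simp only [List.map_cons, List.sum_cons, ih, add_comm h a, qNum_add hq a h]
    ring

theorem list_sum_pointFn_apply {V : Type*} [AddCommGroup V] [Module F V]
    (U : ℕ → Submodule F V) (J : List ℕ) (A : Submodule F V) :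
    (J.map fun a => pointFn (U a)).sum A =
      (((J.map fun a => numPoints (U a ⊓ A)).sum : ℕ) : ℤ) := by
  induction J with
  | nil => simp
  | cons a J ih =>
    rw [List.map_cons, List.sum_cons, List.map_cons, List.sum_cons, Pi.add_apply, ih,
      Nat.cast_add, pointFn]

/-- All `U a` contain the same `X`, so their classes are multiples of one element, `q` times the
class of `X`. The total coefficient is a multiple of `[h+1]_q`, which annihilates it. -/
theorem neg_sum_pointFn_mem_subspaceLattice {V : Type*} [AddCommGroup V] [Module F V] [Finite V]
    {h i : ℕ} (hV : 2 * (h + 1) ≤ finrank F V) {X : Submodule F V} (hX : finrank F X = h)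
    (U : ℕ → Submodule F V) (J : List ℕ)
    (hU : ∀ a ∈ J, X ≤ U a ∧ finrank F (U a) = h + 1 + a)
    (hJ : (J.map (qNum (Nat.card F))).sum = qNum (Nat.card F) (h + 1) * i) :
    -(J.map fun a => pointFn (U a)).sum ∈ subspaceLattice F V (h + 1) := by
  have h1 : ∀ J : List ℕ, (∀ a ∈ J, X ≤ U a ∧ finrank F (U a) = h + 1 + a) →
      (J.map fun a => pointFn (U a)).sum +
        ((J.map (qNum (Nat.card F))).sum * Nat.card F) • pointFn X ∈
          subspaceLattice F V (h + 1) := by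
    intro J hU
    induction J with
    | nil => simp
    | cons a J ih =>
      have h2 := pointFn_add_smul_mem a (hU a (by simp)).1 hX (hU a (by simp)).2
      have h3 := ih fun b hb => hU b (by simp [hb])
      convert AddSubgroup.add_mem _ h2 h3 using 1
      rw [List.map_cons, List.sum_cons, List.map_cons, List.sum_cons, add_mul, add_smul]
      abel
  have h4 : ((J.map (qNum (Nat.card F))).sum * Nat.card F) • pointFn X ∈
      subspaceLattice F V (h + 1) := by
    rw [hJ, mul_right_comm, mul_comm _ i, mul_smul]
    exact AddSubgroup.nsmul_mem _ (qNum_mul_smul_pointFn_mem hX hV) i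
  exact AddSubgroup.neg_mem _ ((AddSubgroup.add_mem_cancel_right _ h4).1 (h1 J hU))

/-- A hyperplane misses either no point of `U a` or exactly `q ^ (h + a)` of them. -/
theorem list_sum_numPoints_le {V : Type*} [AddCommGroup V] [Module F V] [Finite V] {h : ℕ}
    (U : ℕ → Submodule F V) {H : Submodule F V} (hH : finrank F H + 1 = finrank F V)
    (J : List ℕ) (hU : ∀ a ∈ J, finrank F (U a) = h + 1 + a) :
    (J.map fun a => qNum (Nat.card F) (h + 1 + a)).sum ≤
      (J.map fun a => numPoints (U a ⊓ H)).sum +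
        Nat.card F ^ h * (J.map (Nat.card F ^ ·)).sum := by
  have hq := two_le_card F
  induction J with
  | nil => simp
  | cons a J ih =>
    have := ih fun b hb => hU b (by simp [hb])
    have hle : qNum (Nat.card F) (h + 1 + a) ≤ numPoints (U a ⊓ H) + Nat.card F ^ (h + a) := by
      have hUa := hU a (by simp)
      by_cases hle : U a ≤ H
      · rw [inf_eq_left.2 hle, numPoints_eq_of_finrank hUa]
        exact Nat.le_add_right _ _
      · have := finrank_inf_add_one_eq hH hle
        rw [numPoints_eq_of_finrank (by omega : finrank F (U a ⊓ H : Submodule F V) = h + a),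
          show h + 1 + a = h + a + 1 by ring, qNum_succ hq]
    simp only [List.map_cons, List.sum_cons, mul_add]
    rw [pow_add] at hle
    linarith

theorem list_sum_numPoints_eq {V : Type*} [AddCommGroup V] [Module F V] [Finite V] {h : ℕ}
    (U : ℕ → Submodule F V) {H : Submodule F V} (hH : finrank F H + 1 = finrank F V)
    (J : List ℕ) (hU : ∀ a ∈ J, finrank F (U a) = h + 1 + a) (hUH : ∀ a ∈ J, ¬U a ≤ H) :
    (J.map fun a => qNum (Nat.card F) (h + 1 + a)).sum =
      (J.map fun a => numPoints (U a ⊓ H)).sum +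
        Nat.card F ^ h * (J.map (Nat.card F ^ ·)).sum := by
  have hq := two_le_card F
  induction J with
  | nil => simp
  | cons a J ih =>
    have h1 := ih (fun b hb => hU b (by simp [hb])) fun b hb => hUH b (by simp [hb])
    have h2 := finrank_inf_add_one_eq hH (hUH a (by simp))
    have h3 := hU a (by simp)
    simp only [List.map_cons, List.sum_cons, mul_add]
    rw [h1, numPoints_eq_of_finrank (by omega : finrank F (U a ⊓ H : Submodule F V) = h + a),
      show h + 1 + a = h + a + 1 by ring, qNum_succ hq, pow_add]
    ring

/-- Removing subspaces from a multiple of the full point set gives projective systems. -/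
theorem exists_isProjectiveSystem {r h k i y σ m : ℕ} (hr : r = k * (h + 1)) (hk : 2 ≤ k)
    (hm : qNum (Nat.card F) (h + 1) * m = qNum (Nat.card F) r)
    (hσm : m = σ + Nat.card F ^ (r - (h + 1)))
    (J : List ℕ) (hJr : ∀ a ∈ J, h + 1 + a ≤ r)
    (hJi : (J.map (qNum (Nat.card F))).sum = qNum (Nat.card F) (h + 1) * i)
    (hJy : (J.map (Nat.card F ^ ·)).sum = y) :
    ∃ T, ∀ t ≥ T, ∃ S, IsProjectiveSystem F (h + 1) (m * t - (i + y)) r (σ * t - i) S := by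
  classical
  have hq := two_le_card F
  have hV : finrank F (Fin r → F) = r := by simp
  have hr2 : 2 * (h + 1) ≤ r := hr ▸ Nat.mul_le_mul_right _ hk
  -- All removed subspaces will contain `L`. Its subspace `X` serves the lattice argument; a nonzero
  -- vector of `L` later yields a hyperplane containing no `U a`.
  obtain ⟨L, -, -, hL⟩ := exists_le_finrank_eq (bot_le : (⊥ : Submodule F (Fin r → F)) ≤ ⊤)
    (n := h + 1) (by simp) (by rw [finrank_top]; omega)
  obtain ⟨X, -, hXL, hX⟩ := exists_le_finrank_eq (bot_le : ⊥ ≤ L) (n := h) (by simp) (by omega)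
  have hexU : ∀ a, ∃ U, h + 1 + a ≤ r → L ≤ U ∧ finrank F U = h + 1 + a := by
    intro a
    by_cases ha : h + 1 + a ≤ r
    · obtain ⟨U, h1, -, h2⟩ := exists_le_finrank_eq (le_top : L ≤ ⊤) (n := h + 1 + a) (by omega)
        (by rw [finrank_top]; omega)
      exact ⟨U, fun _ => ⟨h1, h2⟩⟩
    · exact ⟨⊤, fun h => absurd h ha⟩
  choose U hU using hexU
  have hmem := neg_sum_pointFn_mem_subspaceLattice (by omega) hX U J
    (fun a ha => ⟨hXL.trans (hU a (hJr a ha)).1, (hU a (hJr a ha)).2⟩) hJi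
  obtain ⟨T, hT⟩ := exists_forall_add_smul_mem_subspaceCone (k := k) (by omega) (by rw [hV, hr])
    (by omega) hmem
  refine ⟨T, fun t ht => ?_⟩
  obtain ⟨S, hS, hSum⟩ := exists_multiset_of_mem_subspaceCone (hT t ht)
  -- `S` and the removed subspaces together cover each point `t` times. Taking `A = ⊤` gives the
  -- length, and `A` a hyperplane gives the number of members inside it.
  have hcount : ∀ A : Submodule F (Fin r → F), (S.map fun W => numPoints (W ⊓ A)).sum +
      (J.map fun a => numPoints (U a ⊓ A)).sum = t * numPoints A := by
    intro A
    have h1 := hSum A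
    simp only [Pi.add_apply, Pi.neg_apply, list_sum_pointFn_apply, nsmul_eq_mul, Pi.mul_apply, Pi.natCast_apply] at h1
    simp only [pointFn, top_inf_eq] at h1
    rw [← Nat.cast_inj (R := ℤ), Nat.cast_add, Nat.cast_mul]
    linarith
  have hUfr : ∀ a ∈ J, finrank F (U a) = h + 1 + a := fun a ha => (hU a (hJr a ha)).2
  have htotal : qNum (Nat.card F) (h + 1) * (S.card + (i + y)) =
      qNum (Nat.card F) (h + 1) * (m * t) := by
    have h1 := hcount ⊤
    simp only [inf_top_eq] at h1
    rw [Multiset.map_congr rfl fun W hW => numPoints_eq_of_finrank (hS W hW),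
      List.map_congr_left fun a ha => numPoints_eq_of_finrank (hUfr a ha), list_sum_qNum_add hq,
      hJi, hJy, Multiset.map_const', Multiset.sum_replicate, smul_eq_mul,
      numPoints_eq_of_finrank (by simp : finrank F (⊤ : Submodule F (Fin r → F)) = r), ← hm] at h1
    linarith
  have hcard : S.card + (i + y) = m * t :=
    Nat.eq_of_mul_eq_mul_left (qNum_pos hq (by omega)) htotal
  have hpoints : ∀ H : Submodule F (Fin r → F), IsHyperplane H →
      Nat.card F ^ h * S.countP (fun W => W ≤ H) + (J.map fun a => numPoints (U a ⊓ H)).sum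
        + Nat.card F ^ h * (Nat.card F ^ (r - (h + 1)) * t) =
      Nat.card F ^ h * S.card + (J.map fun a => qNum (Nat.card F) (h + 1 + a)).sum := by
    intro H hH
    have h1 := hcount H
    rw [sum_numPoints_inf_add S hS hH] at h1
    have hH' : r = finrank F H + 1 := hH.symm
    have h2 : qNum (Nat.card F) r = numPoints H + Nat.card F ^ h * Nat.card F ^ (r - (h + 1)) := by
      rw [← pow_add, show h + (r - (h + 1)) = finrank F H by omega]
      conv_lhs => rw [hH', qNum_succ hq]
      rfl
    rw [list_sum_qNum_add hq, hJi, hJy]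
    rw [← hm] at h2
    have h3 := qNum_succ hq h
    have h4 := congrArg (t * ·) h2
    beta_reduce at h4
    rw [mul_add, ← h1] at h4
    have h5 := htotal
    rw [h3] at h5 h4 ⊢
    linarith
  have hσt : m * t = σ * t + Nat.card F ^ (r - (h + 1)) * t := by rw [hσm, add_mul]
  have hqh : 0 < Nat.card F ^ h := by positivity
  refine ⟨S, by omega, fun W hW => (hS W hW).le, fun H hH => ?_, ?_⟩
  · have h1 := list_sum_numPoints_le (h := h) U (by rw [hV]; exact hH) J hUfr
    have h2 := hpoints H hH
    rw [hJy] at h1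
    have h3 : Nat.card F ^ h * (S.countP (fun W => W ≤ H) + Nat.card F ^ (r - (h + 1)) * t) ≤
        Nat.card F ^ h * (S.card + y) := by
      rw [mul_add, mul_add]; linarith
    have h4 := Nat.le_of_mul_le_mul_left h3 hqh
    omega
  -- A hyperplane avoiding `v` contains no removed subspace, so the estimate of the previous case
  -- becomes an equality.
  · obtain ⟨v, hvL, hv⟩ := (Submodule.ne_bot_iff L).1 (by rintro rfl; simp at hL)
    obtain ⟨H, hH, hvH⟩ := exists_finrank_add_one_eq_not_mem (F := F) hv
    rw [hV] at hH
    refine ⟨H, hH, ?_⟩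
    have h1 := list_sum_numPoints_eq (h := h) U (by rw [hV]; exact hH) J hUfr
      fun a ha hle => hvH (hle ((hU a (hJr a ha)).1 hvL))
    have h2 := hpoints H hH
    rw [hJy] at h1
    have h3 : Nat.card F ^ h * (S.countP (fun W => W ≤ H) + Nat.card F ^ (r - (h + 1)) * t) =
        Nat.card F ^ h * (S.card + y) := by
      rw [mul_add, mul_add]; linarith
    have h4 := Nat.eq_of_mul_eq_mul_left hqh h3
    omega

end Construction

/-! ### Numerical verification and conclusion -/

section MainTheorem

/-- The positions of the base `q` digits of `y`, in decreasing order and with multiplicity. -/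
def digitPositions (q n y : ℕ) : List ℕ :=
  (List.range (n + 1)).reverse.flatMap fun a => List.replicate (y / q ^ a % q) a

/-- Replace the first entry `a` by `q` copies of `a - 1`. This keeps `∑ q ^ a` and lowers `∑ [a]_q`
by one if `0 < a`. -/
def splitHead (q : ℕ) : List ℕ → List ℕ
  | [] => []
  | a :: l => List.replicate q (a - 1) ++ l

/-- A list with `∑ q ^ a = y` and `∑ [a]_q = [h]_q * i`, for suitable parameters. -/
def removedDims (q h n i y : ℕ) : List ℕ :=
  let J := digitPositions q n y
  (splitHead q)^[(J.map (qNum q)).sum - qNum q h * i] J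

/-- Numerical conditions on the parameters for which the maximal length of projective
`(h+1)`-systems in dimension `k * (h+1)` is determined by the Griesmer bound. -/
def GriesmerAttained (q h k m σ i y : ℕ) : Prop :=
  2 ≤ k ∧
  qNum q (h + 1) * m = qNum q (k * (h + 1)) ∧
  m = σ + q ^ (k * (h + 1) - (h + 1)) ∧
  (∀ a ∈ removedDims q (h + 1) (k * (h + 1) - (h + 1)) i y, h + 1 + a ≤ k * (h + 1)) ∧
  ((removedDims q (h + 1) (k * (h + 1) - (h + 1)) i y).map (qNum q)).sum = qNum q (h + 1) * i ∧
  ((removedDims q (h + 1) (k * (h + 1) - (h + 1)) i y).map (q ^ ·)).sum = y ∧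
  i ≤ σ * 2 ∧
  y ≤ q ^ (k * (h + 1) - (h + 1)) * 2 ∧
  qNum q (h + 1) * (m * 2 + 1 - (i + y)) <
    griesmerSum q (k * (h + 1)) (q ^ h * (q ^ (k * (h + 1) - (h + 1)) * 2 + 1 - y))

instance (q h k m σ i y : ℕ) : Decidable (GriesmerAttained q h k m σ i y) := by
  unfold GriesmerAttained; infer_instance

theorem GriesmerAttained.maxLength_eq {F : Type*} [Field F] [Finite F] {h k m σ i y : ℕ}
    (hp : GriesmerAttained (Nat.card F) h k m σ i y) :
    ∀ᶠ t : ℕ in Filter.atTop,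
      maxLength F (k * (h + 1)) (h + 1) (t * σ - i) = ((m * t - (i + y) : ℕ) : ℕ∞) := by
  obtain ⟨hk, hm, hσm, hJr, hJi, hJy, hi, hy, hT⟩ := hp
  obtain ⟨T, hex⟩ := exists_isProjectiveSystem rfl hk hm hσm _ hJr hJi hJy
  filter_upwards [Filter.eventually_ge_atTop T, Filter.eventually_ge_atTop 2] with t ht ht2
  rw [mul_comm t σ]
  refine le_antisymm (sSup_le ?_) (le_sSup ⟨_, hex t ht, rfl⟩)
  rintro _ ⟨n, ⟨S, hS⟩, rfl⟩
  -- The Griesmer inequality was checked at `T = 2`, where none of the subtractions truncates.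
  exact Nat.cast_le.2 (hS.le_of_griesmerSum (Nat.le_mul_of_pos_left _ (by omega)) ht2 hm hσm hi hy hT)

/-- The second instance is the linear case, one-dimensional subspaces over the field with `q ^ h`
elements. It has the same slope and the same `s`, as `[r]_q / [h]_q = [r/h]_{q^h}`, and a `y` larger
by the gain. -/
theorem griesmerAttained_of_mem_improvementSeries :
    ∀ e ∈ improvementSeries, 0 < e.h ∧ e.r = e.r / e.h * e.h ∧ e.i ≤ e.offset ∧ 0 < e.gain ∧
      GriesmerAttained e.q (e.h - 1) (e.r / e.h) e.slope
        (qNum e.q (e.r - e.h) / qNum e.q (Nat.gcd e.r e.h)) e.i (e.offset - e.i) ∧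
      GriesmerAttained (e.q ^ e.h) 0 (e.r / e.h) e.slope
        (qNum e.q (e.r - e.h) / qNum e.q (Nat.gcd e.r e.h)) e.i (e.offset + e.gain - e.i) := by
  decide +kernel

theorem mainTheorem5 (e : Series) (he : e ∈ improvementSeries)
    (F : Type*) [Field F] [Finite F] (hF : Nat.card F = e.q)
    (K : Type*) [Field K] [Finite K] (hK : Nat.card K = e.q ^ e.h) :
    ∀ᶠ t : ℕ in Filter.atTop,
      maxLength F e.r e.h (e.s t) = ((e.slope * t - e.offset : ℕ) : ℕ∞) ∧
      linearMaxLength K e.r e.h (e.s t) < maxLength F e.r e.h (e.s t) ∧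
      maxLength F e.r e.h (e.s t) = linearMaxLength K e.r e.h (e.s t) + (e.gain : ℕ∞) := by
  obtain ⟨hh, hr, hi, hg, hAdd, hLin⟩ := griesmerAttained_of_mem_improvementSeries e he
  have hceil : ⌈(e.r : ℚ) / (e.h : ℚ)⌉₊ = e.r / e.h := by
    rw [← Nat.cast_div ⟨e.r / e.h, by rw [mul_comm]; exact hr⟩ (by positivity), Nat.ceil_natCast]
  have hslope : 1 ≤ e.slope := by
    have : 0 < (e.q ^ e.h) ^ (e.r / e.h * (0 + 1) - (0 + 1)) := by
      rw [← hK]; exact pow_pos Nat.card_pos _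
    rw [hLin.2.2.1]
    exact Nat.add_pos_right _ this
  rw [← hF] at hAdd
  rw [← hK] at hLin
  have hA := hAdd.maxLength_eq
  have hL := hLin.maxLength_eq
  rw [Nat.sub_add_cancel hh, ← hr, hF] at hA
  rw [zero_add, mul_one, ← hceil] at hL
  -- The last condition keeps both lengths from truncating, so that their difference is exactly the
  -- gain.
  filter_upwards [hA, hL, Filter.eventually_ge_atTop (e.offset + e.gain)] with t hAt hLt ht
  have hlt : e.offset + e.gain ≤ e.slope * t := ht.trans (Nat.le_mul_of_pos_left _ hslope)
  rw [Nat.add_sub_cancel' hi] at hAt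
  rw [Nat.add_sub_cancel' (by omega : e.i ≤ e.offset + e.gain)] at hLt
  rw [Series.s, linearMaxLength, hAt, hLt]
  refine ⟨rfl, ?_, ?_⟩
  · exact Nat.cast_lt.2 (by omega)
  · rw [← Nat.cast_add]
    congr 1
    omega

end MainTheorem
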